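/- Let $\mathfrak g$ be a complex Lie algebra with a triangular decomposition in the sense of Moody and Pianzola, that is: - $\mathfrak g=\mathfrak n_-\oplus\mathfrak h\oplus\mathfrak n_+$ as a vector space, with subalgebras $\mathfrak n_\pm$ and an abelian subalgebra $\mathfrak h$; - $\mathfrak n_+$ is the direct sum of its weight spaces $(\mathfrak n_+)_\alpha$ for the adjoint action of $\mathfrak h$, and all its weights are nonzero elements of a free additive semigroup $Q_+\subset\mathfrak h^*$ that has a basis consisting of linearly independent elements of $\mathfrak h^*$; - there is an anti-involution $\sigma$ of $\mathfrak g$ (a linear bijection with $\sigma([x,y])=[\sigma(y),\sigma(x)]$ and $\sigma^2=\mathrm{id}$) with $\sigma|_{\mathfrak h}=\mathrm{id}$ and $\sigma(\mathfrak n_+)=\mathfrak n_-$. Assume that all root spaces $(\mathfrak n_+)_\alpha$ are finite dimensional, and put $\mathfrak n=\mathfrak n_+$. For $\mu\in\mathfrak h^*$ let $$M(\mu)=U(\mathfrak g)\otimes_{U(\mathfrak h\oplus\mathfrak n_+)}\mathbb C_\mu$$ be the Verma module, where $(h+n)v=\mu(h)v$ for $h\in\mathfrak h$, $n\in\mathfrak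 n_+$, $v\in\mathbb C_\mu$, and let $$\overline{M(\mu)}=\prod_{\nu\in\mathfrak h^*}M(\mu)_\nu$$ be its weight completion with the induced $\mathfrak g$-module structure: $(xf)_\nu=\sum_\alpha x_\alpha f_{\nu-\alpha}$ for $x=\sum_\alpha x_\alpha$ with $x_\alpha\in\mathfrak g_\alpha$. For a character $\lambda\in(\mathfrak n/[\mathfrak n,\mathfrak n])^*$, i.e. a Lie algebra homomorphism $\mathfrak n\to\mathbb C$, and a $\mathfrak g$-module $M$ let $$W_\lambda(M)=\{v\in M : xv=\lambda(x)v \text{ for all } x\in\mathfrak n\}$$ be the $\mathfrak n$-submodule of $\lambda$-Whittaker vectors. **Theorem.** If $\mu\in\mathfrak h^*$ is such that $M(\mu)$ is a simple $\mathfrak g$-module, then for every character $\lambda$ of $\mathfrak n$ we have $\dim W_\lambda(\overline{M(\mu)})=1$; in particular, $W_\lambda(\overline{M(\mu)})$ is a simple $\mathfrak n$-module. -/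

import Mathlib

open scoped TensorProduct

attribute [local instance 100] LieRing.ofAssociativeRing

noncomputable section

universe u v

/-- A triangular decomposition `𝔤 = 𝔫₋ ⊕ 𝔥 ⊕ 𝔫₊` of a complex Lie algebra in the sense of
Moody and Pianzola. -/
structure TriangularDecomposition (𝔤 : Type u) [LieRing 𝔤] [LieAlgebra ℂ 𝔤] where
  /-- the Cartan subalgebra `𝔥` -/
  h : LieSubalgebra ℂ 𝔤
  /-- the positive part `𝔫₊` -/
  nPos : LieSubalgebra ℂ 𝔤
  /-- the negative part `𝔫₋` -/
  nNeg : LieSubalgebra ℂ 𝔤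
  /-- `𝔥` is abelian -/
  [abelian : IsLieAbelian h]
  /-- `𝔤 = 𝔫₋ ⊕ 𝔥 ⊕ 𝔫₊` as vector spaces -/
  isInternal : DirectSum.IsInternal ![nNeg.toSubmodule, h.toSubmodule, nPos.toSubmodule]
  /-- the basis of the free additive semigroup `Q₊ ⊆ 𝔥*` -/
  base : Set (Module.Dual ℂ h)
  /-- this basis consists of linearly independent elements of `𝔥*` -/
  base_linearIndependent : LinearIndependent ℂ (fun α : base => (α : Module.Dual ℂ h))
  /-- `𝔫₊` is the sum of its weight spaces for the adjoint action of `𝔥`,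
  for weights which are nonzero elements of `Q₊` -/
  nPos_eq : nPos.toSubmodule =
    ⨆ α ∈ {α : Module.Dual ℂ h | α ∈ AddSubmonoid.closure base ∧ α ≠ 0},
      (LieModule.weightSpace 𝔤 (α : h → ℂ)).toSubmodule ⊓ nPos.toSubmodule
  /-- the anti-involution `σ` of `𝔤` -/
  σ : 𝔤 ≃ₗ[ℂ] 𝔤
  σ_lie : ∀ x y : 𝔤, σ ⁅x, y⁆ = ⁅σ y, σ x⁆
  σ_σ : ∀ x : 𝔤, σ (σ x) = x
  σ_h : ∀ x ∈ h, σ x = x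
  σ_nPos : nPos.toSubmodule.map (σ : 𝔤 →ₗ[ℂ] 𝔤) = nNeg.toSubmodule

namespace TriangularDecomposition

variable {𝔤 : Type u} [LieRing 𝔤] [LieAlgebra ℂ 𝔤] (T : TriangularDecomposition 𝔤)

instance : IsLieAbelian T.h := T.abelian

/-- The weight space `M_ν = {m | x m = ν(x) m for all x ∈ 𝔥}` of a `𝔤`-module `M`. -/
abbrev weightSpace (M : Type v) [AddCommGroup M] [Module ℂ M] [LieRingModule 𝔤 M]
    [LieModule ℂ 𝔤 M] (ν : Module.Dual ℂ T.h) : Submodule ℂ M :=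
  (LieModule.weightSpace M (ν : T.h → ℂ)).toSubmodule

/-! ### The root space decomposition of `𝔤` -/

theorem mem_weightSpace {M : Type v} [AddCommGroup M] [Module ℂ M] [LieRingModule 𝔤 M]
    [LieModule ℂ 𝔤 M] {ν : Module.Dual ℂ T.h} {m : M} :
    m ∈ T.weightSpace M ν ↔ ∀ x : T.h, ⁅(x : 𝔤), m⁆ = ν x • m :=
  LieModule.mem_weightSpace _ m

theorem lie_mem_weightSpace {M : Type v} [AddCommGroup M] [Module ℂ M] [LieRingModule 𝔤 M]
    [LieModule ℂ 𝔤 M] {α ν : Module.Dual ℂ T.h} {x : 𝔤} {m : M}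
    (hx : x ∈ T.weightSpace 𝔤 α) (hm : m ∈ T.weightSpace M ν) :
    ⁅x, m⁆ ∈ T.weightSpace M (α + ν) := by
  rw [mem_weightSpace] at *
  intro y
  rw [leibniz_lie, hx y, hm y, smul_lie, lie_smul, LinearMap.add_apply, add_smul]

theorem iSup_triple : T.nNeg.toSubmodule ⊔ (T.h.toSubmodule ⊔ T.nPos.toSubmodule) = ⊤ := by
  have := T.isInternal.submodule_iSup_eq_top
  rw [iSup_fin_three] at this
  simpa [sup_assoc] using this

theorem isCompl_h : IsCompl T.h.toSubmodule (T.nNeg.toSubmodule ⊔ T.nPos.toSubmodule) := by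
  have := T.isInternal.submodule_iSupIndep 1
  refine ⟨this.mono_right ?_, ?_⟩
  · refine sup_le ?_ ?_
    · exact le_iSup₂_of_le (0 : Fin 3) (by decide) le_rfl
    · exact le_iSup₂_of_le (2 : Fin 3) (by decide) le_rfl
  · rw [codisjoint_iff, sup_left_comm, iSup_triple]

theorem h_le_weightSpace : T.h.toSubmodule ≤ T.weightSpace 𝔤 0 := by
  intro x hx
  rw [mem_weightSpace]
  intro y
  have := congrArg Subtype.val (trivial_lie_zero T.h T.h y ⟨x, hx⟩)
  simpa using this

theorem nPos_le_iSup : T.nPos.toSubmodule ≤ ⨆ α, T.weightSpace 𝔤 α := by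
  rw [T.nPos_eq]
  exact iSup₂_le fun α _ => inf_le_left.trans (le_iSup (fun α => T.weightSpace 𝔤 α) α)

theorem σ_mem_weightSpace {α : Module.Dual ℂ T.h} {x : 𝔤} (hx : x ∈ T.weightSpace 𝔤 α) :
    T.σ x ∈ T.weightSpace 𝔤 (-α) := by
  rw [mem_weightSpace] at *
  intro y
  have h1 := T.σ_lie x (y : 𝔤)
  rw [T.σ_h y y.2, ← lie_skew, hx y] at h1
  rw [← h1]
  simp

theorem nNeg_le_iSup : T.nNeg.toSubmodule ≤ ⨆ α, T.weightSpace 𝔤 α := by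
  rw [← T.σ_nPos, Submodule.map_le_iff_le_comap]
  refine T.nPos_le_iSup.trans (iSup_le fun α x hx => ?_)
  exact (le_iSup (fun α => T.weightSpace 𝔤 α) (-α)) (T.σ_mem_weightSpace hx)

open scoped Classical in
/-- `𝔤` is the direct sum of its weight spaces for the adjoint action of `𝔥`. -/
theorem isInternal_weightSpace : DirectSum.IsInternal (fun α => T.weightSpace 𝔤 α) := by
  refine DirectSum.isInternal_submodule_of_iSupIndep_of_iSup_eq_top ?_ ?_
  · have h1 := LieSubmodule.iSupIndep_toSubmodule.mpr (LieModule.iSupIndep_genWeightSpace ℂ T.h 𝔤)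
    have h2 := h1.comp (f := fun α : Module.Dual ℂ T.h => (α : T.h → ℂ)) DFunLike.coe_injective
    exact h2.mono fun α => LieModule.weightSpace_le_genWeightSpace 𝔤 (α : T.h → ℂ)
  · rw [eq_top_iff, ← T.iSup_triple]
    refine sup_le T.nNeg_le_iSup (sup_le ?_ T.nPos_le_iSup)
    exact T.h_le_weightSpace.trans (le_iSup (fun α => T.weightSpace 𝔤 α) 0)

open scoped Classical in
/-- The identification of `𝔤` with the direct sum of its weight spaces. -/
def rootDecomposition : (DirectSum (Module.Dual ℂ T.h) fun α => T.weightSpace 𝔤 α) ≃ₗ[ℂ] 𝔤 :=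
  LinearEquiv.ofBijective (DirectSum.coeLinearMap fun α => T.weightSpace 𝔤 α)
    T.isInternal_weightSpace

/-! ### Verma modules -/

theorem h_lie_nPos {x y : 𝔤} (hx : x ∈ T.h) (hy : y ∈ T.nPos) : ⁅x, y⁆ ∈ T.nPos := by
  have key : T.nPos.toSubmodule ≤
      T.nPos.toSubmodule.comap (LieModule.toEnd ℂ 𝔤 𝔤 x : 𝔤 →ₗ[ℂ] 𝔤) := by
    conv_lhs => rw [T.nPos_eq]
    refine iSup₂_le fun α _ z hz => ?_
    have := (T.mem_weightSpace.mp hz.1) ⟨x, hx⟩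
    simp only [Submodule.mem_comap, LieModule.toEnd_apply_apply]
    rw [show ⁅x, z⁆ = _ from this]
    exact T.nPos.toSubmodule.smul_mem _ hz.2
  exact key hy

theorem lie_mem_nPos {x y : 𝔤} (hx : x ∈ T.h.toSubmodule ⊔ T.nPos.toSubmodule)
    (hy : y ∈ T.h.toSubmodule ⊔ T.nPos.toSubmodule) : ⁅x, y⁆ ∈ T.nPos := by
  obtain ⟨a, ha, b, hb, rfl⟩ := Submodule.mem_sup.mp hx
  obtain ⟨c, hc, d, hd, rfl⟩ := Submodule.mem_sup.mp hy
  have h1 : ⁅a, c⁆ = 0 := by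
    simpa using congrArg Subtype.val (trivial_lie_zero T.h T.h ⟨a, ha⟩ ⟨c, hc⟩)
  have h2 : ⁅b, c⁆ ∈ T.nPos := by
    rw [← lie_skew]
    exact T.nPos.neg_mem (T.h_lie_nPos hc hb)
  rw [add_lie, lie_add, lie_add, h1, zero_add]
  exact T.nPos.add_mem (T.h_lie_nPos ha hd) (T.nPos.add_mem h2 (T.nPos.lie_mem hb hd))

/-- The subalgebra `𝔟 = 𝔥 ⊕ 𝔫₊`. -/
def borel : LieSubalgebra ℂ 𝔤 where
  __ := T.h.toSubmodule ⊔ T.nPos.toSubmodule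
  lie_mem' {_ _} hx hy :=
    (le_sup_right : T.nPos.toSubmodule ≤ T.h.toSubmodule ⊔ T.nPos.toSubmodule)
      (T.lie_mem_nPos hx hy)

/-- The projection of `𝔤 = 𝔫₋ ⊕ 𝔥 ⊕ 𝔫₊` onto `𝔥`. -/
def projH : 𝔤 →ₗ[ℂ] T.h :=
  Submodule.projectionOnto T.h.toSubmodule (T.nNeg.toSubmodule ⊔ T.nPos.toSubmodule)
    T.isCompl_h

theorem projH_nPos {x : 𝔤} (hx : x ∈ T.nPos) : T.projH x = 0 :=
  (Submodule.projectionOnto_apply_eq_zero_iff T.isCompl_h).mpr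
    ((le_sup_right : T.nPos.toSubmodule ≤ T.nNeg.toSubmodule ⊔ T.nPos.toSubmodule) hx)

/-- The character `h + n ↦ μ(h)` of `𝔟 = 𝔥 ⊕ 𝔫₊`. -/
def borelCharacter (μ : Module.Dual ℂ T.h) : LieAlgebra.LieCharacter ℂ T.borel where
  __ := (μ ∘ₗ T.projH) ∘ₗ T.borel.toSubmodule.subtype
  map_lie' {x y} := by
    have h1 : T.projH ⁅(x : 𝔤), (y : 𝔤)⁆ = 0 := T.projH_nPos (T.lie_mem_nPos x.2 y.2)
    simp [h1, LieRing.of_associative_ring_bracket, mul_comm]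

/-- The inclusion `U(𝔟) → U(𝔤)`. -/
def borelInclusion : UniversalEnvelopingAlgebra ℂ T.borel →ₐ[ℂ] UniversalEnvelopingAlgebra ℂ 𝔤 :=
  UniversalEnvelopingAlgebra.lift ℂ ((UniversalEnvelopingAlgebra.ι ℂ).comp T.borel.incl)

/-- The action `U(𝔟) → ℂ = End(ℂ_μ)` on the one-dimensional module `ℂ_μ`. -/
def borelAction (μ : Module.Dual ℂ T.h) : UniversalEnvelopingAlgebra ℂ T.borel →ₐ[ℂ] ℂ :=
  UniversalEnvelopingAlgebra.lift ℂ (T.borelCharacter μ)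

/-- The Verma module `M(μ) = U(𝔤) ⊗_{U(𝔟)} ℂ_μ`: the quotient of `U(𝔤) ⊗_ℂ ℂ` by the
elements `u b ⊗ z - u ⊗ b z` with `u ∈ U(𝔤)`, `b ∈ U(𝔟)`, `z ∈ ℂ_μ`. -/
def Verma (μ : Module.Dual ℂ T.h) : Type u :=
  (UniversalEnvelopingAlgebra ℂ 𝔤 ⊗[ℂ] ℂ) ⧸
    Submodule.span (UniversalEnvelopingAlgebra ℂ 𝔤)
      {t : UniversalEnvelopingAlgebra ℂ 𝔤 ⊗[ℂ] ℂ |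
        ∃ (w : UniversalEnvelopingAlgebra ℂ 𝔤) (b : UniversalEnvelopingAlgebra ℂ T.borel) (z : ℂ),
          t = (w * T.borelInclusion b) ⊗ₜ[ℂ] z - w ⊗ₜ[ℂ] (T.borelAction μ b * z)}

namespace Verma

variable (μ : Module.Dual ℂ T.h)

instance : AddCommGroup (T.Verma μ) :=
  inferInstanceAs (AddCommGroup ((UniversalEnvelopingAlgebra ℂ 𝔤 ⊗[ℂ] ℂ) ⧸ _))

instance : Module (UniversalEnvelopingAlgebra ℂ 𝔤) (T.Verma μ) :=
  inferInstanceAs (Module (UniversalEnvelopingAlgebra ℂ 𝔤)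
    ((UniversalEnvelopingAlgebra ℂ 𝔤 ⊗[ℂ] ℂ) ⧸ _))

instance : Module ℂ (T.Verma μ) :=
  inferInstanceAs (Module ℂ ((UniversalEnvelopingAlgebra ℂ 𝔤 ⊗[ℂ] ℂ) ⧸ _))

instance : IsScalarTower ℂ (UniversalEnvelopingAlgebra ℂ 𝔤) (T.Verma μ) :=
  inferInstanceAs (IsScalarTower ℂ (UniversalEnvelopingAlgebra ℂ 𝔤)
    ((UniversalEnvelopingAlgebra ℂ 𝔤 ⊗[ℂ] ℂ) ⧸ _))

/-- The `𝔤`-action on `M(μ)` is the restriction of the `U(𝔤)`-action. -/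
instance : LieRingModule 𝔤 (T.Verma μ) where
  bracket x m := UniversalEnvelopingAlgebra.ι ℂ x • m
  add_lie x y m := by
    rw [map_add, add_smul]
  lie_add x m n := smul_add _ m n
  leibniz_lie x y m := by
    change UniversalEnvelopingAlgebra.ι ℂ x • UniversalEnvelopingAlgebra.ι ℂ y • m =
      UniversalEnvelopingAlgebra.ι ℂ ⁅x, y⁆ • m +
        UniversalEnvelopingAlgebra.ι ℂ y • UniversalEnvelopingAlgebra.ι ℂ x • m
    rw [LieHom.map_lie, LieRing.of_associative_ring_bracket, sub_smul, mul_smul, mul_smul,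
      sub_add_cancel]

theorem lie_def (x : 𝔤) (m : T.Verma μ) : ⁅x, m⁆ = UniversalEnvelopingAlgebra.ι ℂ x • m := rfl

instance : LieModule ℂ 𝔤 (T.Verma μ) where
  smul_lie c x m := by rw [lie_def, lie_def, map_smul, smul_assoc]
  lie_smul c x m := by rw [lie_def, lie_def, smul_algebra_smul_comm]

end Verma

/-! ### Completions -/

section Completion

variable (M : Type v) [AddCommGroup M] [Module ℂ M] [LieRingModule 𝔤 M] [LieModule ℂ 𝔤 M]

/-- The completion `∏_{ν ∈ 𝔥*} M_ν`. -/
def Completion : Type (max u v) := (ν : Module.Dual ℂ T.h) → T.weightSpace M ν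

namespace Completion

instance : AddCommGroup (T.Completion M) :=
  inferInstanceAs (AddCommGroup ((ν : Module.Dual ℂ T.h) → T.weightSpace M ν))

instance : Module ℂ (T.Completion M) :=
  inferInstanceAs (Module ℂ ((ν : Module.Dual ℂ T.h) → T.weightSpace M ν))

/-- The action of a root vector `x ∈ 𝔤_α` on the completion: `(x f)_ν = x f_{ν - α}`. -/
def rootAction (α : Module.Dual ℂ T.h) :
    T.weightSpace 𝔤 α →ₗ[ℂ] Module.End ℂ (T.Completion M) :=
  LinearMap.mk₂ ℂ
    (fun (x : T.weightSpace 𝔤 α) (f : T.Completion M) (ν : Module.Dual ℂ T.h) =>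
      (⟨⁅(x : 𝔤), (f (ν - α) : M)⁆, by
        simpa using T.lie_mem_weightSpace x.2 (f (ν - α)).2⟩ : T.weightSpace M ν))
    (fun x y f => funext fun ν => Subtype.ext (add_lie (x : 𝔤) (y : 𝔤) (f (ν - α) : M)))
    (fun c x f => funext fun ν => Subtype.ext (smul_lie c (x : 𝔤) (f (ν - α) : M)))
    (fun x f g => funext fun ν => Subtype.ext (lie_add (x : 𝔤) (f (ν - α) : M) (g (ν - α) : M)))
    (fun c x f => funext fun ν => Subtype.ext (lie_smul c (x : 𝔤) (f (ν - α) : M)))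

open scoped Classical in
/-- The action of `𝔤 = ⊕_α 𝔤_α` on the completion, `(x f)_ν = ∑_α x_α f_{ν - α}`. -/
def action : 𝔤 →ₗ[ℂ] Module.End ℂ (T.Completion M) :=
  DirectSum.toModule ℂ (Module.Dual ℂ T.h) (Module.End ℂ (T.Completion M)) (rootAction T M) ∘ₗ
    (T.rootDecomposition.symm : 𝔤 →ₗ[ℂ] _)

open scoped Classical in
theorem action_apply {α : Module.Dual ℂ T.h} {x : 𝔤} (hx : x ∈ T.weightSpace 𝔤 α)
    (f : T.Completion M) (ν : Module.Dual ℂ T.h) :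
    (action T M x f ν : M) = ⁅x, (f (ν - α) : M)⁆ := by
  have h1 : T.rootDecomposition.symm x =
      DirectSum.lof ℂ (Module.Dual ℂ T.h) (fun α => T.weightSpace 𝔤 α) α ⟨x, hx⟩ := by
    rw [LinearEquiv.symm_apply_eq]
    exact (DirectSum.coeLinearMap_lof (fun α => T.weightSpace 𝔤 α) α (⟨x, hx⟩)).symm
  have h2 : action T M x = rootAction T M α ⟨x, hx⟩ := by
    simp only [action, LinearMap.comp_apply, LinearEquiv.coe_coe, h1]
    exact DirectSum.toModule_lof (φ := rootAction T M) ℂ α (⟨x, hx⟩ : T.weightSpace 𝔤 α)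
  rw [h2]
  rfl

open scoped Classical in
theorem action_lie (x y : 𝔤) : action T M ⁅x, y⁆ = ⁅action T M x, action T M y⁆ := by
  have htop : ⨆ α, T.weightSpace 𝔤 α = ⊤ := T.isInternal_weightSpace.submodule_iSup_eq_top
  have hx : x ∈ ⨆ α, T.weightSpace 𝔤 α := htop ▸ Submodule.mem_top
  have hy : y ∈ ⨆ α, T.weightSpace 𝔤 α := htop ▸ Submodule.mem_top
  induction hx using Submodule.iSup_induction' with
  | zero => simp
  | add a b _ _ ha hb => simp [ha, hb]
  | mem α x hx =>
    induction hy using Submodule.iSup_induction' with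
    | zero => simp
    | add a b _ _ ha hb => simp [ha, hb]
    | mem β y hy =>
      refine LinearMap.ext fun f => funext fun ν => Subtype.ext ?_
      have e1 : ν - α - β = ν - (α + β) := by abel
      have e2 : ν - β - α = ν - (α + β) := by abel
      have h1 : (action T M x (action T M y f) ν : M) = ⁅x, ⁅y, (f (ν - (α + β)) : M)⁆⁆ := by
        rw [action_apply T M hx, action_apply T M hy, e1]
      have h2 : (action T M y (action T M x f) ν : M) = ⁅y, ⁅x, (f (ν - (α + β)) : M)⁆⁆ := by
        rw [action_apply T M hy, action_apply T M hx, e2]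
      have h3 : ((⁅action T M x, action T M y⁆ : Module.End ℂ (T.Completion M)) f ν : M) =
          (action T M x (action T M y f) ν : M) - (action T M y (action T M x f) ν : M) := rfl
      rw [action_apply T M (T.lie_mem_weightSpace hx hy), h3, h1, h2, lie_lie]

/-- The induced `𝔤`-module structure on the completion. -/
instance : LieRingModule 𝔤 (T.Completion M) where
  bracket x f := action T M x f
  add_lie x y f := by
    change action T M (x + y) f = _
    rw [map_add]
    rfl
  lie_add x f g := map_add (action T M x) f g
  leibniz_lie x y f := by
    change action T M x (action T M y f) = action T M ⁅x, y⁆ f + action T M y (action T M x f)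
    rw [action_lie]
    simp [LieRing.of_associative_ring_bracket]

instance : LieModule ℂ 𝔤 (T.Completion M) where
  smul_lie c x f := by
    change action T M (c • x) f = c • action T M x f
    rw [map_smul]
    rfl
  lie_smul c x f := map_smul (action T M x) c f

end Completion

end Completion

end TriangularDecomposition

/-- The `𝔫`-submodule `W_χ(M)` of Whittaker vectors of a `𝔤`-module `M` for a character `χ`
of a subalgebra `𝔫` of `𝔤`: the vectors `v` with `x v = χ(x) v` for all `x ∈ 𝔫`. -/
def whittakerVectors {𝔤 : Type u} [LieRing 𝔤] [LieAlgebra ℂ 𝔤] (𝔫 : LieSubalgebra ℂ 𝔤)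
    (χ : LieAlgebra.LieCharacter ℂ 𝔫) (M : Type v) [AddCommGroup M] [Module ℂ M]
    [LieRingModule 𝔤 M] [LieModule ℂ 𝔤 M] : LieSubmodule ℂ 𝔫 M where
  carrier := {v | ∀ x : 𝔫, ⁅(x : 𝔤), v⁆ = χ x • v}
  zero_mem' x := by simp
  add_mem' {v w} hv hw x := by rw [lie_add, hv x, hw x, smul_add]
  smul_mem' c v hv x := by rw [lie_smul, hv x, smul_comm]
  lie_mem {y v} hv x := by
    have h1 : ⁅y, v⁆ = χ y • v := hv y
    rw [h1, lie_smul, hv x, smul_comm]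

end

/-!
Let `v` be the highest weight vector of `M = M(μ)`. As `M` is simple, its contravariant form is
nondegenerate, and as the weight spaces are finite dimensional, the form identifies the completion
`∏ M_ν` with the full dual of `M = ⨁ M_ν`, where `x ∈ 𝔤` acts on the dual as the transpose of
`σ(x)`. Whittaker vectors for `χ` thus correspond to functionals `F` with `F(y m) = χ(σ(y)) F(m)`
for all `y ∈ 𝔫₋`. Since `M` is free of rank one over `U(𝔫₋)` on `v`, such an `F` is determined by
`F(v)`, which can be prescribed.

Generation of `M` by `v` over `𝔫₋` gives uniqueness of `F`. Existence, usually a consequence of the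
Poincaré–Birkhoff–Witt theorem, is obtained by constructing the action of `𝔤` on `U(𝔫₋)` explicitly,
so that `M` maps to it. For the trivial character `F` is `⟨v, ·⟩`, which yields the contravariant
form itself.
-/

noncomputable section

theorem eq_top_of_lie_mem_of_lieSpan_eq_top {R L M : Type*} [CommRing R] [LieRing L]
    [AddCommGroup M] [Module R M] [LieRingModule L M] {s : Set M}
    (hs : LieSubmodule.lieSpan R L s = ⊤) {S : Submodule R M} (hsS : s ⊆ S)
    (hS : ∀ x : L, ∀ m ∈ S, ⁅x, m⁆ ∈ S) : S = ⊤ := by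
  have hle : LieSubmodule.lieSpan R L s ≤ { S with lie_mem := fun {x m} hm => hS x m hm } :=
    LieSubmodule.lieSpan_le.mpr hsS
  exact top_le_iff.mp fun m _ => hle (hs ▸ LieSubmodule.mem_top m)

theorem lieSpan_subalgebra_eq_top {R L M : Type*} [CommRing R] [LieRing L] [LieAlgebra R L]
    [AddCommGroup M] [Module R M] [LieRingModule L M] [LieModule R L M] (𝔞 : LieSubalgebra R L)
    {s : Set M} (hs : LieSubmodule.lieSpan R L s = ⊤)
    (hL : ∀ y : L, ∀ v ∈ s, ⁅y, v⁆ ∈ LieSubmodule.lieSpan R 𝔞 s) :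
    LieSubmodule.lieSpan R 𝔞 s = ⊤ := by
  have stable (m : M) (hm : m ∈ LieSubmodule.lieSpan R 𝔞 s) :
      ∀ y : L, ⁅y, m⁆ ∈ LieSubmodule.lieSpan R 𝔞 s := by
    induction hm using LieSubmodule.lieSpan_induction with
    | mem v hv => exact fun y => hL y v hv
    | zero => simp
    | add m n _ _ hm hn => exact fun y => lie_add y m n ▸ add_mem (hm y) (hn y)
    | smul c m _ hm => exact fun y => lie_smul c y m ▸ Submodule.smul_mem _ c (hm y)
    | lie x m _ hm =>
      intro y
      rw [LieSubalgebra.coe_bracket_of_module, leibniz_lie]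
      exact add_mem (hm _) (LieSubmodule.lie_mem (x := x) _ (hm y))
  exact (LieSubmodule.toSubmodule_eq_top _).mp <| eq_top_of_lie_mem_of_lieSpan_eq_top hs
    LieSubmodule.subset_lieSpan fun y m hm => stable m hm y

theorem isIrreducible_of_finrank_eq_one {K L M : Type*} [Field K] [LieRing L] [AddCommGroup M]
    [Module K M] [LieRingModule L M] (h : Module.finrank K M = 1) :
    LieModule.IsIrreducible K L M := by
  have hM : IsSimpleModule K M := isSimpleModule_iff_finrank_eq_one.mpr h
  have : Nontrivial M := IsSimpleModule.nontrivial K M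
  refine LieModule.IsIrreducible.mk fun N hN => (LieSubmodule.toSubmodule_eq_top N).mp ?_
  exact (eq_bot_or_eq_top N.toSubmodule).resolve_left
    ((LieSubmodule.toSubmodule_eq_bot N).not.mpr hN)

/-! ### Modules induced from a complementary subalgebra -/

section InducedRep

open UniversalEnvelopingAlgebra

variable {R L : Type*} [CommRing R] [LieRing L] [LieAlgebra R L]

theorem mem_of_one_mem_of_ι_mul_mem {S : Submodule R (UniversalEnvelopingAlgebra R L)}
    (one_mem : 1 ∈ S) (ι_mul_mem : ∀ x : L, ∀ u ∈ S, ι R x * u ∈ S)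
    (u : UniversalEnvelopingAlgebra R L) : u ∈ S := by
  let B : Subalgebra R (UniversalEnvelopingAlgebra R L) :=
    { carrier := {w | ∀ s ∈ S, w * s ∈ S}
      mul_mem' := fun {a b} ha hb s hs => mul_assoc a b s ▸ ha _ (hb s hs)
      add_mem' := fun {a b} ha hb s hs => add_mul a b s ▸ S.add_mem (ha s hs) (hb s hs)
      algebraMap_mem' := fun r s hs => Algebra.smul_def r s ▸ S.smul_mem r hs }
  let f : L →ₗ⁅R⁆ B :=
    { (ι R : L →ₗ⁅R⁆ UniversalEnvelopingAlgebra R L).toLinearMap.codRestrict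
        B.toSubmodule ι_mul_mem with
      map_lie' := Subtype.ext (LieHom.map_lie _ _ _) }
  have val_comp_lift : B.val.comp (lift R f) = AlgHom.id R _ := by
    refine hom_ext R (LieHom.ext fun x => ?_)
    exact congrArg Subtype.val (lift_ι_apply R f x)
  have lift_coe : (lift R f u : UniversalEnvelopingAlgebra R L) = u :=
    DFunLike.congr_fun val_comp_lift u
  simpa only [lift_coe, mul_one] using (lift R f u).2 1 one_mem

theorem universalEnvelopingAlgebra_induction_left
    {motive : UniversalEnvelopingAlgebra R L → Prop} (one : motive 1)
    (add : ∀ u w, motive u → motive w → motive (u + w))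
    (smul : ∀ (c : R) (u), motive u → motive (c • u))
    (ι_mul : ∀ (x : L) (u), motive u → motive (ι R x * u))
    (u : UniversalEnvelopingAlgebra R L) : motive u :=
  mem_of_one_mem_of_ι_mul_mem
    (S := { carrier := {u | motive u}
            add_mem' := fun {u w} hu hw => add u w hu hw
            zero_mem' := zero_smul R (1 : UniversalEnvelopingAlgebra R L) ▸ smul 0 1 one
            smul_mem' := smul })
    one ι_mul u

/-- The action of `L` on `U(L)` by left multiplication. -/
instance leftMulLieRingModule : LieRingModule L (UniversalEnvelopingAlgebra R L) where
  bracket x u := ι R x * u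
  add_lie x y u := by rw [map_add, add_mul]
  lie_add x u w := mul_add _ u w
  leibniz_lie x y u := by
    change ι R x * (ι R y * u) = ι R ⁅x, y⁆ * u + ι R y * (ι R x * u)
    rw [LieHom.map_lie, LieRing.of_associative_ring_bracket, sub_mul, mul_assoc, mul_assoc,
      sub_add_cancel]

theorem lie_eq_ι_mul (x : L) (u : UniversalEnvelopingAlgebra R L) : ⁅x, u⁆ = ι R x * u := rfl

instance leftMulLieModule : LieModule R L (UniversalEnvelopingAlgebra R L) where
  smul_lie c x u := by rw [lie_eq_ι_mul, map_smul, smul_mul_assoc, lie_eq_ι_mul]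
  lie_smul c x u := mul_smul_comm c (ι R x) u

section InducedAction

variable {𝔞 : LieSubalgebra R L} (φ : L →ₗ[R] UniversalEnvelopingAlgebra R 𝔞)

/-- The family of endomorphisms of `U(𝔞)` indexed by `y : L` which is forced by `y 1 = φ y` and the
commutation rule `y (x u) = x (y u) + [y, x] u` for `x ∈ 𝔞`. It is obtained by letting `U(𝔞)` act
on `φ`, an element of the `𝔞`-module of linear maps `L → U(𝔞)`. -/
def inducedAction : L →ₗ[R] Module.End R (UniversalEnvelopingAlgebra R 𝔞) :=
  (LinearMap.applyₗ φ ∘ₗ (lift R (LieModule.toEnd R 𝔞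
    (L →ₗ[R] UniversalEnvelopingAlgebra R 𝔞))).toLinearMap).flip

theorem inducedAction_one (y : L) : inducedAction φ y 1 = φ y := by
  simp [inducedAction]

theorem inducedAction_ι_mul (y : L) (x : 𝔞) (u : UniversalEnvelopingAlgebra R 𝔞) :
    inducedAction φ y (ι R x * u) =
      ι R x * inducedAction φ y u + inducedAction φ ⁅y, (x : L)⁆ u := by
  let ψ := lift R (LieModule.toEnd R 𝔞 (L →ₗ[R] UniversalEnvelopingAlgebra R 𝔞))
  change ψ (ι R x * u) φ y = ι R x * ψ u φ y + ψ u φ ⁅y, (x : L)⁆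
  rw [map_mul, lift_ι_apply, Module.End.mul_apply, LieModule.toEnd_apply_apply,
    LieHom.lie_apply, lie_eq_ι_mul, LieSubalgebra.coe_bracket_of_module, ← lie_skew y (x : L),
    map_neg, sub_eq_add_neg]

variable {φ}

theorem inducedAction_coe (hφ : ∀ x : 𝔞, φ x = ι R x) (x : 𝔞)
    (u : UniversalEnvelopingAlgebra R 𝔞) : inducedAction φ x u = ι R x * u := by
  induction u using universalEnvelopingAlgebra_induction_left generalizing x with
  | one => rw [inducedAction_one, hφ, mul_one]
  | add u w hu hw => rw [map_add, hu, hw, mul_add]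
  | smul c u hu => rw [map_smul, hu, mul_smul_comm]
  | ι_mul y u hu =>
    have comm : ι R x * ι R y = ι R y * ι R x + ι R ⁅x, y⁆ := by
      rw [LieHom.map_lie, LieRing.of_associative_ring_bracket, add_sub_cancel]
    rw [inducedAction_ι_mul, ← LieSubalgebra.coe_bracket, hu, hu, ← mul_assoc, ← mul_assoc, comm,
      add_mul]

theorem inducedAction_lie
    (h : ∀ y z : L, φ ⁅y, z⁆ = inducedAction φ y (φ z) - inducedAction φ z (φ y)) (y z : L) :
    inducedAction φ ⁅y, z⁆ = ⁅inducedAction φ y, inducedAction φ z⁆ := by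
  refine LinearMap.ext fun u => ?_
  rw [LieRing.of_associative_ring_bracket, LinearMap.sub_apply, Module.End.mul_apply,
    Module.End.mul_apply]
  induction u using universalEnvelopingAlgebra_induction_left generalizing y z with
  | one => simpa only [inducedAction_one] using h y z
  | add u w hu hw =>
    simp only [map_add, hu, hw]
    abel
  | smul c u hu => simp only [map_smul, hu, smul_sub]
  | ι_mul x u hu =>
    have jacobi : ⁅⁅y, z⁆, (x : L)⁆ = ⁅⁅y, (x : L)⁆, z⁆ + ⁅y, ⁅z, (x : L)⁆⁆ := by
      rw [lie_lie y z, ← lie_skew z ⁅y, (x : L)⁆, sub_neg_eq_add, add_comm]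
    simp only [inducedAction_ι_mul, map_add, jacobi, LinearMap.add_apply, hu, mul_sub]
    abel

end InducedAction

variable {𝔞 𝔟 : LieSubalgebra R L} (h : IsCompl 𝔞.toSubmodule 𝔟.toSubmodule)
  (μ : LieAlgebra.LieCharacter R 𝔟)

/-- The map `L = 𝔞 ⊕ 𝔟 → U(𝔞)` which is the inclusion on `𝔞` and `μ` on `𝔟`: the action of `L` on
the generator of the module induced from `μ`, when this module is identified with `U(𝔞)`. -/
def actionOnGenerator : L →ₗ[R] UniversalEnvelopingAlgebra R 𝔞 :=
  (ι R : 𝔞 →ₗ⁅R⁆ UniversalEnvelopingAlgebra R 𝔞).toLinearMap ∘ₗ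
      Submodule.projectionOnto 𝔞.toSubmodule 𝔟.toSubmodule h +
    ((μ : 𝔟 →ₗ[R] R) ∘ₗ Submodule.projectionOnto 𝔟.toSubmodule 𝔞.toSubmodule h.symm).smulRight 1

theorem actionOnGenerator_left (x : 𝔞) : actionOnGenerator h μ x = ι R x := by
  have hp := Submodule.projectionOnto_apply_left h x
  have hq := Submodule.projectionOnto_apply_right h.symm x
  simp [actionOnGenerator, hp, hq]

theorem actionOnGenerator_right (x : 𝔟) : actionOnGenerator h μ x = μ x • 1 := by
  have hp := Submodule.projectionOnto_apply_right h x
  have hq := Submodule.projectionOnto_apply_left h.symm x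
  simp [actionOnGenerator, hp, hq]

theorem actionOnGenerator_lie_left (x : 𝔞) (z : L) :
    actionOnGenerator h μ ⁅(x : L), z⁆ =
      inducedAction (actionOnGenerator h μ) x (actionOnGenerator h μ z) -
        inducedAction (actionOnGenerator h μ) z (actionOnGenerator h μ x) := by
  have commute_one := inducedAction_ι_mul (actionOnGenerator h μ) z x 1
  rw [mul_one, inducedAction_one, inducedAction_one] at commute_one
  rw [inducedAction_coe (actionOnGenerator_left h μ), actionOnGenerator_left, commute_one,
    sub_add_cancel_left, ← map_neg, lie_skew]

theorem actionOnGenerator_lie_right (x y : 𝔟) :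
    actionOnGenerator h μ ⁅(x : L), (y : L)⁆ =
      inducedAction (actionOnGenerator h μ) x (actionOnGenerator h μ y) -
        inducedAction (actionOnGenerator h μ) y (actionOnGenerator h μ x) := by
  rw [← LieSubalgebra.coe_bracket, actionOnGenerator_right, LieAlgebra.lieCharacter_apply_lie,
    actionOnGenerator_right, actionOnGenerator_right, map_smul, map_smul, inducedAction_one,
    inducedAction_one, actionOnGenerator_right, actionOnGenerator_right, smul_comm, zero_smul,
    sub_self]

theorem actionOnGenerator_lie (y z : L) :
    actionOnGenerator h μ ⁅y, z⁆ =
      inducedAction (actionOnGenerator h μ) y (actionOnGenerator h μ z) -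
        inducedAction (actionOnGenerator h μ) z (actionOnGenerator h μ y) := by
  have left := actionOnGenerator_lie_left h μ
  have decompose (y : L) : ∃ (a : 𝔞) (b : 𝔟), (a : L) + b = y :=
    ⟨_, _, Submodule.projection_add_projection_eq_self h y⟩
  obtain ⟨a, b, rfl⟩ := decompose y
  obtain ⟨a', b', rfl⟩ := decompose z
  have right : actionOnGenerator h μ ⁅(b : L), (a' : L)⁆ =
      inducedAction (actionOnGenerator h μ) b (actionOnGenerator h μ a') -
        inducedAction (actionOnGenerator h μ) a' (actionOnGenerator h μ b) := by
    rw [← lie_skew, map_neg, left, neg_sub]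
  simp only [add_lie, lie_add, map_add, LinearMap.add_apply, left, right,
    actionOnGenerator_lie_right]
  abel

/-- The module induced from a character `μ` of `𝔟`, realised on `U(𝔞)` for a complementary
subalgebra `𝔞`. -/
def inducedRep : L →ₗ⁅R⁆ Module.End R (UniversalEnvelopingAlgebra R 𝔞) where
  __ := inducedAction (actionOnGenerator h μ)
  map_lie' {y z} := inducedAction_lie (actionOnGenerator_lie h μ) y z

theorem inducedRep_left (x : 𝔞) (u : UniversalEnvelopingAlgebra R 𝔞) :
    inducedRep h μ x u = ι R x * u :=
  inducedAction_coe (actionOnGenerator_left h μ) x u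

theorem inducedRep_right_one (x : 𝔟) : inducedRep h μ x 1 = μ x • 1 :=
  (inducedAction_one _ _).trans (actionOnGenerator_right h μ x)

end InducedRep

section WhittakerFunctionals

/-- The linear functionals on an `L`-module on which `L` acts through a character `χ`. They are
dual to Whittaker vectors. -/
def whittakerFunctionals {R L : Type*} [CommRing R] [LieRing L] [LieAlgebra R L]
    (χ : LieAlgebra.LieCharacter R L) (M : Type*) [AddCommGroup M] [Module R M]
    [LieRingModule L M] : Submodule R (Module.Dual R M) where
  carrier := {F | ∀ (x : L) (m : M), F ⁅x, m⁆ = χ x * F m}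
  zero_mem' _ _ := (mul_zero _).symm
  add_mem' {F G} hF hG x m := by simp only [LinearMap.add_apply, hF x m, hG x m, mul_add]
  smul_mem' c F hF x m := by simp only [LinearMap.smul_apply, hF x m, mul_smul_comm]

theorem eq_zero_of_mem_whittakerFunctionals {R L M : Type*} [CommRing R] [LieRing L]
    [LieAlgebra R L] [AddCommGroup M] [Module R M] [LieRingModule L M]
    {χ : LieAlgebra.LieCharacter R L} {v : M} (hgen : LieSubmodule.lieSpan R L {v} = ⊤)
    {F : Module.Dual R M} (hF : F ∈ whittakerFunctionals χ M) (hFv : F v = 0) : F = 0 := by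
  refine LinearMap.ker_eq_top.mp <| eq_top_of_lie_mem_of_lieSpan_eq_top hgen
    (Set.singleton_subset_iff.mpr hFv) fun x m hm => ?_
  rw [LinearMap.mem_ker, hF, LinearMap.mem_ker.mp hm, mul_zero]

theorem finrank_whittakerFunctionals_eq_one {K L M : Type*} [Field K] [LieRing L]
    [LieAlgebra K L] [AddCommGroup M] [Module K M] [LieRingModule L M]
    {χ : LieAlgebra.LieCharacter K L} {v : M} (hgen : LieSubmodule.lieSpan K L {v} = ⊤)
    {F : Module.Dual K M} (hF : F ∈ whittakerFunctionals χ M) (hFv : F v = 1) :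
    Module.finrank K (whittakerFunctionals χ M) = 1 := by
  let F₀ : whittakerFunctionals χ M := ⟨F, hF⟩
  have F₀_ne_zero : F₀ ≠ 0 := fun h =>
    one_ne_zero (hFv.symm.trans (DFunLike.congr_fun (congrArg Subtype.val h) v))
  refine finrank_eq_one F₀ F₀_ne_zero fun G => ⟨(G : Module.Dual K M) v, ?_⟩
  refine sub_eq_zero.mp (Subtype.ext ?_)
  refine eq_zero_of_mem_whittakerFunctionals hgen (Subtype.prop _) ?_
  simp [F₀, hFv]

end WhittakerFunctionals

namespace TriangularDecomposition

variable {𝔤 : Type u} [LieRing 𝔤] [LieAlgebra ℂ 𝔤] (T : TriangularDecomposition 𝔤)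

section Subalgebras

theorem isCompl_nNeg_borel : IsCompl T.nNeg.toSubmodule T.borel.toSubmodule := by
  refine ⟨(T.isInternal.submodule_iSupIndep 0).mono_right (sup_le ?_ ?_), ?_⟩
  · exact le_iSup₂_of_le (1 : Fin 3) (by decide) le_rfl
  · exact le_iSup₂_of_le (2 : Fin 3) (by decide) le_rfl
  · exact codisjoint_iff.mpr T.iSup_triple

theorem projH_coe (x : T.h) : T.projH x = x :=
  Submodule.projectionOnto_apply_left T.isCompl_h x

theorem σ_mem_nNeg {x : 𝔤} (hx : x ∈ T.nPos) : T.σ x ∈ T.nNeg := by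
  rw [← LieSubalgebra.mem_toSubmodule, ← T.σ_nPos]
  exact Submodule.mem_map_of_mem hx

theorem σ_mem_nPos {x : 𝔤} (hx : x ∈ T.nNeg) : T.σ x ∈ T.nPos := by
  rw [← LieSubalgebra.mem_toSubmodule, ← T.σ_nPos] at hx
  obtain ⟨y, hy, rfl⟩ := hx
  exact (T.σ_σ y).symm ▸ hy

theorem h_lie_nNeg {x y : 𝔤} (hx : x ∈ T.h) (hy : y ∈ T.nNeg) : ⁅x, y⁆ ∈ T.nNeg := by
  have lie_eq : ⁅x, y⁆ = T.σ ⁅T.σ y, x⁆ := by rw [T.σ_lie, T.σ_σ, T.σ_h x hx]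
  rw [lie_eq, ← lie_skew, map_neg]
  exact neg_mem (T.σ_mem_nNeg (T.h_lie_nPos hx (T.σ_mem_nPos hy)))

/-- The character `x ↦ χ(σ(x))` of `𝔫₋`. -/
def oppositeCharacter (χ : LieAlgebra.LieCharacter ℂ T.nPos) :
    LieAlgebra.LieCharacter ℂ T.nNeg where
  __ := (χ : T.nPos →ₗ[ℂ] ℂ) ∘ₗ
    (T.σ : 𝔤 →ₗ[ℂ] 𝔤).restrict (p := T.nNeg.toSubmodule) (q := T.nPos.toSubmodule)
      fun _ hx => T.σ_mem_nPos hx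
  map_lie' {x y} := by
    have σ_lie_eq : (⟨T.σ ⁅(x : 𝔤), (y : 𝔤)⁆, T.σ_mem_nPos (⁅x, y⁆ : T.nNeg).2⟩ : T.nPos) =
        ⁅(⟨T.σ y, T.σ_mem_nPos y.2⟩ : T.nPos), (⟨T.σ x, T.σ_mem_nPos x.2⟩ : T.nPos)⁆ :=
      Subtype.ext (T.σ_lie x y)
    refine (congrArg χ σ_lie_eq).trans ?_
    rw [LieAlgebra.lieCharacter_apply_lie, LieRing.of_associative_ring_bracket, mul_comm, sub_self]

theorem oppositeCharacter_σ (χ : LieAlgebra.LieCharacter ℂ T.nPos) (x : T.nPos) :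
    T.oppositeCharacter χ ⟨T.σ x, T.σ_mem_nNeg x.2⟩ = χ x :=
  congrArg χ (Subtype.ext (T.σ_σ x))

end Subalgebras

section Roots

/-- The element of `Q₊ ∪ {0}` with given coordinates in the basis of `Q₊`. -/
def ofCoords : (T.base →₀ ℕ) →ₗ[ℕ] Module.Dual ℂ T.h :=
  Finsupp.linearCombination ℕ (fun α : T.base => (α : Module.Dual ℂ T.h))

theorem ofCoords_injective : Function.Injective T.ofCoords :=
  T.base_linearIndependent.restrict_scalars (R := ℕ) fun a b h => by simpa using h

theorem exists_ofCoords_eq {α : Module.Dual ℂ T.h} (hα : α ∈ AddSubmonoid.closure T.base) :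
    ∃ β, T.ofCoords β = α := by
  induction hα using AddSubmonoid.closure_induction with
  | mem x hx => exact ⟨Finsupp.single ⟨x, hx⟩ 1, by simp [ofCoords]⟩
  | zero => exact ⟨0, map_zero _⟩
  | add x y _ _ hx hy =>
    obtain ⟨a, rfl⟩ := hx
    obtain ⟨b, rfl⟩ := hy
    exact ⟨a + b, map_add _ _ _⟩

/-- The root space of `𝔫₋` for the root `-β`, where `β` is given by its coordinates. -/
def nNegRootSpace (β : T.base →₀ ℕ) : Submodule ℂ 𝔤 :=
  T.weightSpace 𝔤 (-T.ofCoords β) ⊓ T.nNeg.toSubmodule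

theorem finiteDimensional_nNegRootSpace (β : T.base →₀ ℕ)
    [FiniteDimensional ℂ ↥(T.weightSpace 𝔤 (T.ofCoords β) ⊓ T.nPos.toSubmodule)] :
    FiniteDimensional ℂ (T.nNegRootSpace β) := by
  have le_map_σ : T.nNegRootSpace β ≤
      (T.weightSpace 𝔤 (T.ofCoords β) ⊓ T.nPos.toSubmodule).map (T.σ : 𝔤 →ₗ[ℂ] 𝔤) := by
    rintro x ⟨hx, hx'⟩
    refine ⟨T.σ x, ⟨?_, T.σ_mem_nPos hx'⟩, T.σ_σ x⟩
    exact neg_neg (T.ofCoords β) ▸ T.σ_mem_weightSpace hx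
  exact Submodule.finiteDimensional_of_le le_map_σ

theorem nNeg_le_iSup_nNegRootSpace :
    T.nNeg.toSubmodule ≤ ⨆ β ∈ {β : T.base →₀ ℕ | β ≠ 0}, T.nNegRootSpace β := by
  rw [← T.σ_nPos, Submodule.map_le_iff_le_comap, T.nPos_eq]
  refine iSup₂_le fun α hα x hx => ?_
  obtain ⟨β, rfl⟩ := T.exists_ofCoords_eq hα.1
  have β_ne_zero : β ≠ 0 := fun h => hα.2 (h ▸ map_zero _)
  exact Submodule.mem_iSup_of_mem β <| Submodule.mem_iSup_of_mem β_ne_zero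
    ⟨T.σ_mem_weightSpace hx.1, T.σ_mem_nNeg hx.2⟩

end Roots

/-! ### Weight spaces of highest weight modules -/

section HighestWeightModule

variable {M : Type v} [AddCommGroup M] [Module ℂ M] [LieRingModule 𝔤 M] [LieModule ℂ 𝔤 M]

variable (M) in
theorem iSupIndep_weightSpace : iSupIndep fun ν => T.weightSpace M ν := by
  have indep := LieSubmodule.iSupIndep_toSubmodule.mpr (LieModule.iSupIndep_genWeightSpace ℂ T.h M)
  exact (indep.comp (f := fun ν : Module.Dual ℂ T.h => (ν : T.h → ℂ)) DFunLike.coe_injective).mono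
    fun ν => LieModule.weightSpace_le_genWeightSpace M (ν : T.h → ℂ)

variable {T} {μ : Module.Dual ℂ T.h} {v : M}

theorem lie_mem_weightSpace_sub_ofCoords {α β : T.base →₀ ℕ} {x : 𝔤} {m : M}
    (hx : x ∈ T.nNegRootSpace α) (hm : m ∈ T.weightSpace M (μ - T.ofCoords β)) :
    ⁅x, m⁆ ∈ T.weightSpace M (μ - T.ofCoords (α + β)) := by
  have weight_eq : -T.ofCoords α + (μ - T.ofCoords β) = μ - T.ofCoords (α + β) := by
    rw [map_add]
    abel
  exact weight_eq ▸ T.lie_mem_weightSpace hx.1 hm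

theorem iSup_eq_top_of_nNegRootSpace_lie_mem (hgen : LieSubmodule.lieSpan ℂ T.nNeg {v} = ⊤)
    {F : (T.base →₀ ℕ) → Submodule ℂ M} (hv : v ∈ F 0)
    (hF : ∀ α ≠ 0, ∀ x ∈ T.nNegRootSpace α, ∀ β, ∀ m ∈ F β, ⁅x, m⁆ ∈ F (α + β)) :
    ⨆ β, F β = ⊤ := by
  refine eq_top_of_lie_mem_of_lieSpan_eq_top hgen
    (Set.singleton_subset_iff.mpr (Submodule.mem_iSup_of_mem 0 hv)) fun x m hm => ?_
  induction hm using Submodule.iSup_induction' with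
  | zero => simp
  | add m n _ _ hm hn => exact lie_add x m n ▸ add_mem hm hn
  | mem β m hm =>
    have nNeg_le : T.nNeg.toSubmodule ≤
        (⨆ β, F β).comap ((LieModule.toEnd ℂ 𝔤 M).toLinearMap.flip m) :=
      T.nNeg_le_iSup_nNegRootSpace.trans <| iSup₂_le fun α hα y hy =>
        Submodule.mem_iSup_of_mem (α + β) (hF α hα y hy β m hm)
    exact nNeg_le x.2

theorem iSup_weightSpace_sub_ofCoords (hv : v ∈ T.weightSpace M μ)
    (hgen : LieSubmodule.lieSpan ℂ T.nNeg {v} = ⊤) :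
    ⨆ β, T.weightSpace M (μ - T.ofCoords β) = ⊤ :=
  iSup_eq_top_of_nNegRootSpace_lie_mem hgen (by rwa [map_zero, sub_zero])
    fun _ _ _ hx _ _ hm => lie_mem_weightSpace_sub_ofCoords hx hm

theorem iSup_weightSpace_eq_top (hv : v ∈ T.weightSpace M μ)
    (hgen : LieSubmodule.lieSpan ℂ T.nNeg {v} = ⊤) : ⨆ ν, T.weightSpace M ν = ⊤ :=
  top_le_iff.mp <| iSup_weightSpace_sub_ofCoords hv hgen ▸ iSup_comp_le _ _

theorem exists_eq_sub_ofCoords (hv : v ∈ T.weightSpace M μ)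
    (hgen : LieSubmodule.lieSpan ℂ T.nNeg {v} = ⊤) {ν : Module.Dual ℂ T.h}
    (hν : T.weightSpace M ν ≠ ⊥) : ∃ β, μ - T.ofCoords β = ν :=
  (T.iSupIndep_weightSpace M).mem_of_biSup_eq_top (s := Set.range fun β => μ - T.ofCoords β)
    (iSup_range.trans (iSup_weightSpace_sub_ofCoords hv hgen)) hν

open scoped Classical in
variable (M μ) in
/-- The part of `M_{μ-β}` which is reached by root vectors of `𝔫₋` from higher weight spaces. -/
def loweredSpace (β : T.base →₀ ℕ) : Submodule ℂ M :=
  ⨆ p ∈ (Finset.HasAntidiagonal.antidiagonal β).filter (fun p => p.1 ≠ 0),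
    Submodule.map₂ (LieModule.toEnd ℂ 𝔤 M).toLinearMap (T.nNegRootSpace p.1)
      (T.weightSpace M (μ - T.ofCoords p.2))

theorem lie_mem_loweredSpace {α β : T.base →₀ ℕ} (hα : α ≠ 0) {x : 𝔤} {m : M}
    (hx : x ∈ T.nNegRootSpace α) (hm : m ∈ T.weightSpace M (μ - T.ofCoords β)) :
    ⁅x, m⁆ ∈ loweredSpace M μ (α + β) := by
  classical
  refine Submodule.mem_iSup_of_mem (α, β) (Submodule.mem_iSup_of_mem ?_ ?_)
  · exact Finset.mem_filter.mpr ⟨Finset.HasAntidiagonal.mem_antidiagonal.mpr rfl, hα⟩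
  · exact Submodule.apply_mem_map₂ (LieModule.toEnd ℂ 𝔤 M).toLinearMap hx hm

theorem weightSpace_le_span_sup_loweredSpace (hv : v ∈ T.weightSpace M μ)
    (hgen : LieSubmodule.lieSpan ℂ T.nNeg {v} = ⊤) (β : T.base →₀ ℕ) :
    T.weightSpace M (μ - T.ofCoords β) ≤ ℂ ∙ v ⊔ loweredSpace M μ β := by
  -- The `F β` sum to `M`, as their sum contains `v` and is stable under `𝔫₋`; hence none of them
  -- can be smaller than the weight space containing it.
  let F (β : T.base →₀ ℕ) : Submodule ℂ M :=
    (ℂ ∙ v ⊔ loweredSpace M μ β) ⊓ T.weightSpace M (μ - T.ofCoords β)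
  have iSup_F : ⨆ β, F β = ⊤ := by
    refine iSup_eq_top_of_nNegRootSpace_lie_mem hgen ⟨?_, ?_⟩ fun α hα x hx β m hm => ⟨?_, ?_⟩
    · exact Submodule.mem_sup_left (Submodule.mem_span_singleton_self v)
    · rwa [map_zero, sub_zero]
    · exact Submodule.mem_sup_right (lie_mem_loweredSpace hα hx hm.2)
    · exact lie_mem_weightSpace_sub_ofCoords hx hm.2
  have indep : iSupIndep fun β => T.weightSpace M (μ - T.ofCoords β) :=
    (T.iSupIndep_weightSpace M).comp (sub_right_injective.comp T.ofCoords_injective)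
  have F_eq : F = fun β => T.weightSpace M (μ - T.ofCoords β) :=
    (indep.le_iff_eq_of_iSup_eq_top iSup_F).mp fun β => inf_le_right
  exact (congrFun F_eq β).ge.trans inf_le_left

theorem finiteDimensional_weightSpace_sub_ofCoords
    (hfin : ∀ α : Module.Dual ℂ T.h,
      FiniteDimensional ℂ ↥(T.weightSpace 𝔤 α ⊓ T.nPos.toSubmodule))
    (hv : v ∈ T.weightSpace M μ) (hgen : LieSubmodule.lieSpan ℂ T.nNeg {v} = ⊤)
    (β : T.base →₀ ℕ) : FiniteDimensional ℂ (T.weightSpace M (μ - T.ofCoords β)) := by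
  classical
  induction hd : β.degree using Nat.strong_induction_on generalizing β with
  | _ d ih =>
    have fg_loweredSpace : (loweredSpace M μ β).FG := by
      refine Submodule.fg_biSup _ _ fun p hp => ?_
      obtain ⟨sum_eq, hp1⟩ := Finset.mem_filter.mp hp
      have degree_lt : p.2.degree < d := by
        have degree_pos := (Finsupp.degree_eq_zero_iff p.1).not.mpr hp1
        rw [← hd, ← Finset.HasAntidiagonal.mem_antidiagonal.mp sum_eq, map_add]
        omega
      exact Submodule.FG.map₂ _ (Module.Finite.iff_fg.mp (T.finiteDimensional_nNegRootSpace p.1))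
        (Module.Finite.iff_fg.mp (ih _ degree_lt p.2 rfl))
    have := Module.Finite.iff_fg.mpr ((Submodule.fg_span_singleton v).sup fg_loweredSpace)
    exact Submodule.finiteDimensional_of_le (weightSpace_le_span_sup_loweredSpace hv hgen β)

theorem finiteDimensional_weightSpace
    (hfin : ∀ α : Module.Dual ℂ T.h,
      FiniteDimensional ℂ ↥(T.weightSpace 𝔤 α ⊓ T.nPos.toSubmodule))
    (hv : v ∈ T.weightSpace M μ) (hgen : LieSubmodule.lieSpan ℂ T.nNeg {v} = ⊤)
    (ν : Module.Dual ℂ T.h) : FiniteDimensional ℂ (T.weightSpace M ν) := by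
  by_cases hν : T.weightSpace M ν = ⊥
  · rw [hν]
    infer_instance
  · obtain ⟨β, rfl⟩ := exists_eq_sub_ofCoords hv hgen hν
    exact finiteDimensional_weightSpace_sub_ofCoords hfin hv hgen β

end HighestWeightModule

/-! ### Contravariant forms and completions -/

section ContravariantForm

section Irreducible

variable {M : Type v} [AddCommGroup M] [Module ℂ M] [LieRingModule 𝔤 M]

/-- A bilinear form on a `𝔤`-module is contravariant if the anti-involution `σ` takes elements of
`𝔤` to their adjoints. -/
def IsContravariant (B : M →ₗ[ℂ] Module.Dual ℂ M) : Prop :=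
  ∀ (x : 𝔤) (m m' : M), B ⁅x, m⁆ m' = B m ⁅T.σ x, m'⁆

variable {T} {B : M →ₗ[ℂ] Module.Dual ℂ M}

theorem IsContravariant.ker_eq_bot [LieModule.IsIrreducible ℂ 𝔤 M] (hB : T.IsContravariant B)
    (hB_ne : B ≠ 0) : LinearMap.ker B = ⊥ := by
  let N : LieSubmodule ℂ 𝔤 M :=
    { LinearMap.ker B with
      lie_mem := fun {x m} hm => LinearMap.mem_ker.mpr <| LinearMap.ext fun m' => by
        rw [hB, show B m = 0 from hm, LinearMap.zero_apply, LinearMap.zero_apply] }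
  have N_ne_top : N ≠ ⊤ := fun h =>
    hB_ne (LinearMap.ker_eq_top.mp ((LieSubmodule.toSubmodule_eq_top N).mpr h))
  exact (LieSubmodule.toSubmodule_eq_bot N).mpr ((eq_bot_or_eq_top N).resolve_right N_ne_top)

end Irreducible

variable (M : Type v) [AddCommGroup M] [Module ℂ M] [LieRingModule 𝔤 M] [LieModule ℂ 𝔤 M]

section DualRep

/-- The `𝔤`-action on the dual space of a `𝔤`-module which is twisted by the anti-involution. -/
def dualRep : 𝔤 →ₗ⁅ℂ⁆ Module.End ℂ (Module.Dual ℂ M) where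
  toFun x := LinearMap.lcomp ℂ ℂ (LieModule.toEnd ℂ 𝔤 M (T.σ x))
  map_add' x y := LinearMap.ext fun F => LinearMap.ext fun m => by simp
  map_smul' c x := LinearMap.ext fun F => LinearMap.ext fun m => by simp
  map_lie' {x y} := LinearMap.ext fun F => LinearMap.ext fun m => by
    simp [LieRing.of_associative_ring_bracket, T.σ_lie]

variable {T M} {μ : Module.Dual ℂ T.h} {v : M} {F : Module.Dual ℂ M}

theorem apply_h_lie_of_mem_whittakerFunctionals_zero (hv : v ∈ T.weightSpace M μ)
    (hgen : LieSubmodule.lieSpan ℂ T.nNeg {v} = ⊤)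
    (hF : F ∈ whittakerFunctionals (0 : LieAlgebra.LieCharacter ℂ T.nNeg) M) (y : T.h) (m : M) :
    F ⁅(y : 𝔤), m⁆ = μ y * F m := by
  have F_nNeg_lie (x : 𝔤) (hx : x ∈ T.nNeg) (m : M) : F ⁅x, m⁆ = 0 :=
    (hF ⟨x, hx⟩ m).trans (zero_mul _)
  let G : Module.Dual ℂ M := F ∘ₗ LieModule.toEnd ℂ 𝔤 M (y : 𝔤) - μ y • F
  have hG : G ∈ whittakerFunctionals (0 : LieAlgebra.LieCharacter ℂ T.nNeg) M := fun x m => by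
    change F ⁅(y : 𝔤), ⁅(x : 𝔤), m⁆⁆ - μ y * F ⁅(x : 𝔤), m⁆ = 0 * G m
    rw [leibniz_lie, map_add, F_nNeg_lie _ (T.h_lie_nNeg y.2 x.2), F_nNeg_lie _ x.2,
      F_nNeg_lie _ x.2, mul_zero, zero_mul, add_zero, sub_zero]
  have hGv : G v = 0 := by
    change F ⁅(y : 𝔤), v⁆ - μ y * F v = 0
    rw [T.mem_weightSpace.mp hv, map_smul, smul_eq_mul, sub_self]
  exact sub_eq_zero.mp (DFunLike.congr_fun (eq_zero_of_mem_whittakerFunctionals hgen hG hGv) m)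

theorem dualRep_borel_of_mem_whittakerFunctionals_zero (hv : v ∈ T.weightSpace M μ)
    (hgen : LieSubmodule.lieSpan ℂ T.nNeg {v} = ⊤)
    (hF : F ∈ whittakerFunctionals (0 : LieAlgebra.LieCharacter ℂ T.nNeg) M) (x : T.borel) :
    T.dualRep M x F = T.borelCharacter μ x • F := by
  obtain ⟨x, hx⟩ := x
  obtain ⟨y, hy, z, hz, rfl⟩ := Submodule.mem_sup.mp hx
  have projH_eq : T.projH (y + z) = ⟨y, hy⟩ := by
    rw [map_add, T.projH_nPos hz, add_zero]
    exact T.projH_coe ⟨y, hy⟩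
  refine LinearMap.ext fun m => ?_
  change F ⁅T.σ (y + z), m⁆ = μ (T.projH (y + z)) * F m
  have F_σ_z : F ⁅T.σ z, m⁆ = 0 := (hF ⟨T.σ z, T.σ_mem_nNeg hz⟩ m).trans (zero_mul _)
  rw [map_add, T.σ_h y hy, add_lie, map_add, F_σ_z, add_zero, projH_eq]
  exact apply_h_lie_of_mem_whittakerFunctionals_zero hv hgen hF ⟨y, hy⟩ m

end DualRep

variable {T M}

theorem dual_ext_weightSpace (hM : ⨆ ν, T.weightSpace M ν = ⊤) {F G : Module.Dual ℂ M}
    (h : ∀ ν, ∀ m ∈ T.weightSpace M ν, F m = G m) : F = G :=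
  LinearMap.eqLocus_eq_top.mp (top_le_iff.mp (hM ▸ iSup_le h))

section CompletionDual

variable {B : M →ₗ[ℂ] Module.Dual ℂ M}

theorem IsContravariant.apply_eq_zero (hB : T.IsContravariant B) {ν ν' : Module.Dual ℂ T.h}
    (hν : ν ≠ ν') {m m' : M} (hm : m ∈ T.weightSpace M ν) (hm' : m' ∈ T.weightSpace M ν') :
    B m m' = 0 := by
  obtain ⟨x, hx⟩ := DFunLike.exists_ne hν
  have weight_mul_eq := hB (x : 𝔤) m m'
  rw [T.σ_h _ x.2, T.mem_weightSpace.mp hm, T.mem_weightSpace.mp hm', map_smul, map_smul,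
    LinearMap.smul_apply, smul_eq_mul, smul_eq_mul] at weight_mul_eq
  exact (mul_eq_mul_right_iff.mp weight_mul_eq).resolve_left hx

theorem IsContravariant.injective_domRestrict (hB : T.IsContravariant B)
    (hker : LinearMap.ker B = ⊥) (hM : ⨆ ν, T.weightSpace M ν = ⊤) (ν : Module.Dual ℂ T.h) :
    Function.Injective (B.domRestrict₁₂ (T.weightSpace M ν) (T.weightSpace M ν)) := by
  refine (injective_iff_map_eq_zero _).mpr fun m hm => Subtype.ext ?_
  refine LinearMap.ker_eq_bot'.mp hker m (dual_ext_weightSpace hM fun ν' m' hm' => ?_)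
  obtain rfl | hν := eq_or_ne ν ν'
  · exact DFunLike.congr_fun hm ⟨m', hm'⟩
  · exact hB.apply_eq_zero hν m.2 hm'

variable [∀ ν, FiniteDimensional ℂ (T.weightSpace M ν)]

/-- A nondegenerate contravariant form identifies the completion `∏_ν M_ν` with the full dual of
`M = ⨁_ν M_ν`, provided that all `M_ν` are finite dimensional. -/
def completionDualEquiv (hB : T.IsContravariant B) (hker : LinearMap.ker B = ⊥)
    (hM : ⨆ ν, T.weightSpace M ν = ⊤) : T.Completion M ≃ₗ[ℂ] Module.Dual ℂ M := by
  classical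
  exact
    (LinearEquiv.piCongrRight fun ν => LinearMap.linearEquivOfInjective
        (B.domRestrict₁₂ (T.weightSpace M ν) (T.weightSpace M ν))
        (hB.injective_domRestrict hker hM ν) Subspace.dual_finrank_eq.symm) ≪≫ₗ
      DFinsupp.lsum ℂ ≪≫ₗ ((T.iSupIndep_weightSpace M).linearEquiv hM).symm.dualMap

section

variable (hB : T.IsContravariant B) (hker : LinearMap.ker B = ⊥)
  (hM : ⨆ ν, T.weightSpace M ν = ⊤)

theorem completionDualEquiv_apply (f : T.Completion M) {ν : Module.Dual ℂ T.h} {m : M}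
    (hm : m ∈ T.weightSpace M ν) : completionDualEquiv hB hker hM f m = B (f ν) m := by
  classical
  change DFinsupp.lsum ℂ _ (((T.iSupIndep_weightSpace M).linearEquiv hM).symm m) = _
  rw [iSupIndep.linearEquiv_symm_apply _ _ hm, DFinsupp.lsum_single]
  rfl

theorem completionDualEquiv_lie (x : 𝔤) (f : T.Completion M) :
    completionDualEquiv hB hker hM ⁅x, f⁆ = T.dualRep M x (completionDualEquiv hB hker hM f) := by
  classical
  have hx : x ∈ ⨆ α, T.weightSpace 𝔤 α :=
    T.isInternal_weightSpace.submodule_iSup_eq_top ▸ Submodule.mem_top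
  induction hx using Submodule.iSup_induction' with
  | zero => simp
  | add x y _ _ hx hy => rw [add_lie, map_add, map_add, hx, hy, LinearMap.add_apply]
  | mem α x hx =>
    refine dual_ext_weightSpace hM fun ν m hm => ?_
    have σ_lie_mem : ⁅T.σ x, m⁆ ∈ T.weightSpace M (ν - α) :=
      neg_add_eq_sub α ν ▸ T.lie_mem_weightSpace (T.σ_mem_weightSpace hx) hm
    calc completionDualEquiv hB hker hM ⁅x, f⁆ m
        = B ((⁅x, f⁆ : T.Completion M) ν) m := completionDualEquiv_apply hB hker hM _ hm
      _ = B ⁅x, (f (ν - α) : M)⁆ m := by rw [← Completion.action_apply T M hx f ν]; rfl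
      _ = B (f (ν - α)) ⁅T.σ x, m⁆ := hB x _ m
      _ = completionDualEquiv hB hker hM f ⁅T.σ x, m⁆ :=
        (completionDualEquiv_apply hB hker hM f σ_lie_mem).symm

theorem mem_whittakerVectors_completion_iff {χ : LieAlgebra.LieCharacter ℂ T.nPos}
    {f : T.Completion M} :
    f ∈ whittakerVectors T.nPos χ (T.Completion M) ↔
      completionDualEquiv hB hker hM f ∈ whittakerFunctionals (T.oppositeCharacter χ) M := by
  have mem_iff : f ∈ whittakerVectors T.nPos χ (T.Completion M) ↔
      ∀ (x : T.nPos) (m : M), completionDualEquiv hB hker hM f ⁅T.σ x, m⁆ =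
        χ x * completionDualEquiv hB hker hM f m := by
    refine forall_congr' fun x => ?_
    rw [← (completionDualEquiv hB hker hM).injective.eq_iff, map_smul, completionDualEquiv_lie]
    exact LinearMap.ext_iff
  refine mem_iff.trans ⟨fun h x m => ?_, fun h x m => ?_⟩
  · have at_σ := h ⟨T.σ x, T.σ_mem_nPos x.2⟩ m
    rwa [T.σ_σ] at at_σ
  · rw [← T.oppositeCharacter_σ]
    exact h ⟨T.σ x, T.σ_mem_nNeg x.2⟩ m

end

theorem finrank_whittakerVectors_completion (hB : T.IsContravariant B)
    (hker : LinearMap.ker B = ⊥) (hM : ⨆ ν, T.weightSpace M ν = ⊤)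
    (χ : LieAlgebra.LieCharacter ℂ T.nPos) :
    Module.finrank ℂ (whittakerVectors T.nPos χ (T.Completion M)) =
      Module.finrank ℂ (whittakerFunctionals (T.oppositeCharacter χ) M) := by
  have comap_eq : (whittakerVectors T.nPos χ (T.Completion M)).toSubmodule =
      (whittakerFunctionals (T.oppositeCharacter χ) M).comap
        (completionDualEquiv hB hker hM : T.Completion M →ₗ[ℂ] Module.Dual ℂ M) :=
    Submodule.ext fun _ => mem_whittakerVectors_completion_iff hB hker hM
  exact ((LinearEquiv.ofEq _ _ comap_eq).trans
    ((completionDualEquiv hB hker hM).ofSubmodule' _)).finrank_eq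

end CompletionDual

end ContravariantForm

/-! ### The contravariant form on a Verma module -/

open UniversalEnvelopingAlgebra

variable (μ : Module.Dual ℂ T.h)

theorem borelInclusion_ι (x : T.borel) : T.borelInclusion (ι ℂ x) = ι ℂ (x : 𝔤) :=
  lift_ι_apply ℂ _ x

theorem borelAction_ι (x : T.borel) : T.borelAction μ (ι ℂ x) = T.borelCharacter μ x :=
  lift_ι_apply ℂ _ x

theorem borelCharacter_h (y : T.h) :
    T.borelCharacter μ ⟨y, Submodule.mem_sup_left y.2⟩ = μ y :=
  congrArg μ (T.projH_coe y)

namespace Verma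

section Generator

/-- The quotient map from `U(𝔤) ⊗_ℂ ℂ` to `M(μ) = U(𝔤) ⊗_{U(𝔟)} ℂ_μ`. -/
def mk : UniversalEnvelopingAlgebra ℂ 𝔤 ⊗[ℂ] ℂ →ₗ[UniversalEnvelopingAlgebra ℂ 𝔤] T.Verma μ :=
  Submodule.mkQ _

theorem mk_surjective : Function.Surjective (mk T μ) :=
  Submodule.mkQ_surjective _

theorem mk_mul_tmul (w : UniversalEnvelopingAlgebra ℂ 𝔤)
    (b : UniversalEnvelopingAlgebra ℂ T.borel) (z : ℂ) :
    mk T μ ((w * T.borelInclusion b) ⊗ₜ z) = mk T μ (w ⊗ₜ (T.borelAction μ b * z)) :=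
  (Submodule.Quotient.eq _).mpr (Submodule.subset_span ⟨w, b, z, rfl⟩)

/-- The canonical generator `1 ⊗ 1` of the Verma module. -/
def highestWeightVector : T.Verma μ :=
  mk T μ (1 ⊗ₜ 1)

theorem smul_highestWeightVector (w : UniversalEnvelopingAlgebra ℂ 𝔤) :
    w • highestWeightVector T μ = mk T μ (w ⊗ₜ 1) := by
  rw [highestWeightVector, ← map_smul, TensorProduct.smul_tmul', smul_eq_mul, mul_one]

theorem exists_smul_highestWeightVector (m : T.Verma μ) :
    ∃ w : UniversalEnvelopingAlgebra ℂ 𝔤, w • highestWeightVector T μ = m := by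
  obtain ⟨t, rfl⟩ := mk_surjective T μ m
  refine ⟨TensorProduct.rid ℂ _ t, ?_⟩
  rw [smul_highestWeightVector, ← TensorProduct.rid_symm_apply, LinearEquiv.symm_apply_apply]

theorem borel_lie_highestWeightVector (x : T.borel) :
    ⁅(x : 𝔤), highestWeightVector T μ⁆ = T.borelCharacter μ x • highestWeightVector T μ := by
  have relation := mk_mul_tmul T μ 1 (ι ℂ x) 1
  rw [borelInclusion_ι, borelAction_ι, one_mul, ← smul_eq_mul (T.borelCharacter μ x),
    ← TensorProduct.smul_tmul] at relation
  rw [lie_def, smul_highestWeightVector, relation, ← smul_highestWeightVector, smul_assoc,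
    one_smul]

theorem highestWeightVector_mem_weightSpace :
    highestWeightVector T μ ∈ T.weightSpace (T.Verma μ) μ :=
  T.mem_weightSpace.mpr fun y =>
    (borel_lie_highestWeightVector T μ ⟨y, Submodule.mem_sup_left y.2⟩).trans
      (T.borelCharacter_h μ y ▸ rfl)

theorem lieSpan_highestWeightVector :
    LieSubmodule.lieSpan ℂ 𝔤 {highestWeightVector T μ} = ⊤ := by
  refine top_le_iff.mp fun m _ => ?_
  obtain ⟨w, rfl⟩ := exists_smul_highestWeightVector T μ m
  induction w using universalEnvelopingAlgebra_induction_left with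
  | one =>
    rw [one_smul]
    exact LieSubmodule.subset_lieSpan (Set.mem_singleton _)
  | add u w hu hw =>
    rw [add_smul]
    exact add_mem (hu trivial) (hw trivial)
  | smul c u hu =>
    rw [smul_assoc]
    exact Submodule.smul_mem _ c (hu trivial)
  | ι_mul x u hu =>
    rw [mul_smul, ← lie_def]
    exact LieSubmodule.lie_mem _ (hu trivial)

theorem lieSpan_nNeg_highestWeightVector :
    LieSubmodule.lieSpan ℂ T.nNeg {highestWeightVector T μ} = ⊤ := by
  refine lieSpan_subalgebra_eq_top T.nNeg (lieSpan_highestWeightVector T μ) fun y v hv => ?_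
  obtain rfl := Set.mem_singleton_iff.mp hv
  obtain ⟨x, z, rfl⟩ : ∃ (x : T.nNeg) (z : T.borel), (x : 𝔤) + z = y :=
    ⟨_, _, Submodule.projection_add_projection_eq_self T.isCompl_nNeg_borel y⟩
  have v_mem := LieSubmodule.subset_lieSpan (R := ℂ) (L := T.nNeg) hv
  rw [add_lie, borel_lie_highestWeightVector]
  exact add_mem (LieSubmodule.lie_mem _ (x := x) v_mem) (Submodule.smul_mem _ _ v_mem)

end Generator

section UniversalProperty

variable {T μ} {N : Type v} [AddCommGroup N] [Module ℂ N] (ρ : 𝔤 →ₗ⁅ℂ⁆ Module.End ℂ N) (n : N)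

/-- The map `U(𝔤) ⊗ ℂ → N`, `w ⊗ z ↦ z w n`. -/
def preLift : (UniversalEnvelopingAlgebra ℂ 𝔤 ⊗[ℂ] ℂ) →ₗ[ℂ] N :=
  LinearMap.applyₗ n ∘ₗ (UniversalEnvelopingAlgebra.lift ℂ ρ).toLinearMap ∘ₗ
    (TensorProduct.rid ℂ _).toLinearMap

theorem preLift_tmul (w : UniversalEnvelopingAlgebra ℂ 𝔤) (z : ℂ) :
    preLift ρ n (w ⊗ₜ z) = z • UniversalEnvelopingAlgebra.lift ℂ ρ w n := by
  simp [preLift]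

theorem preLift_smul (w : UniversalEnvelopingAlgebra ℂ 𝔤)
    (t : UniversalEnvelopingAlgebra ℂ 𝔤 ⊗[ℂ] ℂ) :
    preLift ρ n (w • t) = UniversalEnvelopingAlgebra.lift ℂ ρ w (preLift ρ n t) := by
  induction t using TensorProduct.induction_on with
  | zero => simp only [smul_zero, map_zero]
  | add a b ha hb => rw [smul_add, map_add, ha, hb, map_add, map_add]
  | tmul u z =>
    rw [TensorProduct.smul_tmul', preLift_tmul, preLift_tmul, smul_eq_mul, map_mul, map_smul,
      Module.End.mul_apply]

variable {n}

theorem lift_borelInclusion (hn : ∀ x : T.borel, ρ x n = T.borelCharacter μ x • n)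
    (b : UniversalEnvelopingAlgebra ℂ T.borel) :
    UniversalEnvelopingAlgebra.lift ℂ ρ (T.borelInclusion b) n = T.borelAction μ b • n := by
  induction b using universalEnvelopingAlgebra_induction_left with
  | one => simp only [map_one, Module.End.one_apply, one_smul]
  | add u w hu hw => rw [map_add, map_add, LinearMap.add_apply, hu, hw, map_add, add_smul]
  | smul c u hu => rw [map_smul, map_smul, LinearMap.smul_apply, hu, map_smul, smul_assoc]
  | ι_mul x u hu =>
    rw [map_mul, map_mul, Module.End.mul_apply, hu, map_smul, borelInclusion_ι, lift_ι_apply, hn,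
      map_mul, borelAction_ι, smul_smul, mul_comm]

theorem preLift_eq_zero (hn : ∀ x : T.borel, ρ x n = T.borelCharacter μ x • n)
    {t : UniversalEnvelopingAlgebra ℂ 𝔤 ⊗[ℂ] ℂ} (ht : mk T μ t = 0) : preLift ρ n t = 0 := by
  replace ht := (Submodule.Quotient.mk_eq_zero _).mp ht
  induction ht using Submodule.span_induction with
  | zero => exact map_zero _
  | add a b _ _ ha hb => rw [map_add, ha, hb, add_zero]
  | smul w t _ ht => rw [preLift_smul, ht, map_zero]
  | mem t ht =>
    obtain ⟨w, b, z, rfl⟩ := ht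
    rw [map_sub, preLift_tmul, preLift_tmul, map_mul, Module.End.mul_apply,
      lift_borelInclusion ρ hn, map_smul, smul_smul, mul_comm z, sub_self]

variable (hn : ∀ x : T.borel, ρ x n = T.borelCharacter μ x • n)

/-- The homomorphism from the Verma module to a `𝔤`-module given by a vector on which `𝔟` acts
through `μ`: the universal property of the Verma module. -/
def lift : T.Verma μ →ₗ[ℂ] N where
  __ := QuotientAddGroup.lift _ (preLift ρ n).toAddMonoidHom
    fun _ ht => preLift_eq_zero ρ hn ((Submodule.Quotient.mk_eq_zero _).mpr ht)
  map_smul' c m := by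
    obtain ⟨t, rfl⟩ := mk_surjective T μ m
    exact map_smul (preLift ρ n) c t

theorem lift_mk (t : UniversalEnvelopingAlgebra ℂ 𝔤 ⊗[ℂ] ℂ) :
    lift ρ hn (mk T μ t) = preLift ρ n t := rfl

theorem lift_highestWeightVector : lift ρ hn (highestWeightVector T μ) = n := by
  rw [highestWeightVector, lift_mk, preLift_tmul, map_one, one_smul, Module.End.one_apply]

theorem lift_lie (x : 𝔤) (m : T.Verma μ) : lift ρ hn ⁅x, m⁆ = ρ x (lift ρ hn m) := by
  obtain ⟨t, rfl⟩ := mk_surjective T μ m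
  rw [lie_def, ← map_smul, lift_mk, lift_mk, preLift_smul, lift_ι_apply]

end UniversalProperty

/-- The `𝔫₋`-equivariant map from `M(μ)` to `U(𝔫₋)` which takes the highest weight vector to `1`. -/
def toNNeg : T.Verma μ →ₗ[ℂ] UniversalEnvelopingAlgebra ℂ T.nNeg :=
  lift (inducedRep T.isCompl_nNeg_borel (T.borelCharacter μ))
    (inducedRep_right_one T.isCompl_nNeg_borel (T.borelCharacter μ))

/-- The functional on `M(μ)` with value `1` at the highest weight vector on which `𝔫₋` acts
through the character `χ`. -/
def whittakerFunctional (χ : LieAlgebra.LieCharacter ℂ T.nNeg) : Module.Dual ℂ (T.Verma μ) :=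
  (UniversalEnvelopingAlgebra.lift ℂ χ).toLinearMap ∘ₗ toNNeg T μ

theorem whittakerFunctional_highestWeightVector (χ : LieAlgebra.LieCharacter ℂ T.nNeg) :
    whittakerFunctional T μ χ (highestWeightVector T μ) = 1 := by
  rw [whittakerFunctional, LinearMap.comp_apply, toNNeg, lift_highestWeightVector,
    AlgHom.toLinearMap_apply, map_one]

theorem whittakerFunctional_mem_whittakerFunctionals (χ : LieAlgebra.LieCharacter ℂ T.nNeg) :
    whittakerFunctional T μ χ ∈ whittakerFunctionals χ (T.Verma μ) := fun x m => by
  change UniversalEnvelopingAlgebra.lift ℂ χ (toNNeg T μ ⁅(x : 𝔤), m⁆) =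
    χ x * UniversalEnvelopingAlgebra.lift ℂ χ (toNNeg T μ m)
  rw [toNNeg, lift_lie, inducedRep_left, map_mul, lift_ι_apply]

theorem finrank_whittakerFunctionals (χ : LieAlgebra.LieCharacter ℂ T.nNeg) :
    Module.finrank ℂ (whittakerFunctionals χ (T.Verma μ)) = 1 :=
  finrank_whittakerFunctionals_eq_one (lieSpan_nNeg_highestWeightVector T μ)
    (whittakerFunctional_mem_whittakerFunctionals T μ χ)
    (whittakerFunctional_highestWeightVector T μ χ)

/-- The contravariant form on `M(μ)` with value `1` at the pair of highest weight vectors. -/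
def contravariantForm : T.Verma μ →ₗ[ℂ] Module.Dual ℂ (T.Verma μ) :=
  lift (T.dualRep (T.Verma μ)) <| dualRep_borel_of_mem_whittakerFunctionals_zero
    (highestWeightVector_mem_weightSpace T μ) (lieSpan_nNeg_highestWeightVector T μ)
    (whittakerFunctional_mem_whittakerFunctionals T μ 0)

theorem isContravariant_contravariantForm : T.IsContravariant (contravariantForm T μ) :=
  fun x m m' => DFunLike.congr_fun (lift_lie _ _ x m) m'

theorem contravariantForm_highestWeightVector :
    contravariantForm T μ (highestWeightVector T μ) = whittakerFunctional T μ 0 :=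
  lift_highestWeightVector _ _

theorem contravariantForm_ne_zero : contravariantForm T μ ≠ 0 := fun h => by
  have form_eq_one := whittakerFunctional_highestWeightVector T μ 0
  rw [← contravariantForm_highestWeightVector, h] at form_eq_one
  exact zero_ne_one form_eq_one

end Verma

end TriangularDecomposition

end

open TriangularDecomposition

/-- Whittaker vectors in the completion of a simple Verma module. -/
theorem theorem45 {𝔤 : Type*} [LieRing 𝔤] [LieAlgebra ℂ 𝔤] (T : TriangularDecomposition 𝔤)
    (hfin : ∀ α : Module.Dual ℂ T.h,
      FiniteDimensional ℂ ↥(T.weightSpace 𝔤 α ⊓ T.nPos.toSubmodule))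
    (μ : Module.Dual ℂ T.h) (hμ : LieModule.IsIrreducible ℂ 𝔤 (T.Verma μ))
    (χ : LieAlgebra.LieCharacter ℂ T.nPos) :
    Module.finrank ℂ (whittakerVectors T.nPos χ (T.Completion (T.Verma μ))) = 1 ∧
      LieModule.IsIrreducible ℂ T.nPos
        (whittakerVectors T.nPos χ (T.Completion (T.Verma μ))) := by
  have hv := Verma.highestWeightVector_mem_weightSpace T μ
  have hgen := Verma.lieSpan_nNeg_highestWeightVector T μ
  have hB := Verma.isContravariant_contravariantForm T μ
  have hker := hB.ker_eq_bot (Verma.contravariantForm_ne_zero T μ)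
  have hM := iSup_weightSpace_eq_top hv hgen
  have finiteDimensional_verma := finiteDimensional_weightSpace hfin hv hgen
  have finrank_eq_one :
      Module.finrank ℂ (whittakerVectors T.nPos χ (T.Completion (T.Verma μ))) = 1 :=
    (finrank_whittakerVectors_completion hB hker hM χ).trans
      (Verma.finrank_whittakerFunctionals T μ (T.oppositeCharacter χ))
  exact ⟨finrank_eq_one, isIrreducible_of_finrank_eq_one finrank_eq_one⟩
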